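/- **Conventions.** A \emph{Clifford semigroup} is a semilattice of groups: a semigroup $S$ with a surjective homomorphism onto a semilattice, all of whose fibres are groups. Composition of morphisms is written from left to right. For a semigroup $S$ with set of idempotents $E(S)$: * $\mathbb{R}(S)$ is the category with objects the right ideals $eS$, $e\in E(S)$, and with morphisms $eS\to fS$ the maps $\lambda(e,u,f)\colon x\mapsto ux$, $u\in fSe$; $\mathbb{L}(S)$ is the category with objects the left ideals $Se$, $e\in E(S)$, and with morphisms $Se\to Sf$ the maps $\rho(e,u,f)\colon x\mapsto xu$, $u\in eSf$. In both, the inclusions are the inclusion maps of ideals. If $S$ is regular (in particular, if it is Clifford), both are normal categories in the following sense. * A \emph{category with subobjects} is a small category $\mathcal{C}$ with a partial order $\subseteq$ on its objects and monomorphisms $\iota(a,b)\colon a\to b$, one for each pair $a\subseteq b$, called inclusions, such that $\iota(a,a)=1_a$, $\iota(a,b)\,\iota(b,c)=\iota(a,c)$, and every $h$ such that $h\,\iota(b,c)$ is an inclusion is itself an inclusion. A \emph{normal cone} $\gamma$ with apex $d=c_\gamma$ is a family of morphisms $\gamma(c)\colon c\to d$, one for each object $c$, such that $\iota(a,b)\,\gamma(b)=\gamma(a)$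 whenever $a\subseteq b$, and such that some $\gamma(m)$ is an isomorphism. $\mathcal{C}$ is a \emph{normal category} if every inclusion has a right inverse (a retraction), every morphism is a product $f=quj$ of a retraction $q$, an isomorphism $u$ and an inclusion $j$, and for every object $c$ there is a normal cone $\gamma$ with apex $c$ and $\gamma(c)=1_c$. Then $f^\circ=qu$ depends only on $f$; its codomain is the image of $f$. * For a normal cone $\gamma$ and $f\colon c_\gamma\to c$, let $\gamma * f^\circ$ be the normal cone with components $\gamma(a)f^\circ$. The normal cones in $\mathcal{C}$ form a semigroup $T\mathcal{C}$ under $\gamma\cdot\sigma=\gamma*(\sigma(c_\gamma))^\circ$. * For $\gamma\in T\mathcal{C}$, the set-valued functor $H(\gamma;-)$ on $\mathcal{C}$ is given by $H(\gamma;c)=\{\gamma*f^\circ : f\in\mathcal{C}(c_\gamma,c)\}$ and $H(\gamma;g)\colon\gamma*f^\circ\mapsto\gamma*(fg)^\circ$. The \emph{normal dual} $N^*\mathcal{C}$ is the category whose objects are the functors $H(\varepsilon;-)$, $\varepsilon\in E(T\mathcal{C})$, whose morphisms are all natural transformations between them, and whose inclusions are the inclusions of subfunctors. **Theorem.** Let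 $S$ be a Clifford semigroup. Then the semigroup $T\mathbb{R}(S)$ of all normal cones in $\mathbb{R}(S)$ is anti-isomorphic to $S$. Moreover, the normal dual $N^*\mathbb{R}(S)$ is isomorphic to $\mathbb{L}(S)$ as a normal category: there are mutually inverse functors between $N^*\mathbb{R}(S)$ and $\mathbb{L}(S)$, both of which map inclusions to inclusions. -/

import Mathlib

open CategoryTheory

namespace CrossConnection

universe v u

section NormalCategories

/-- A category with subobjects: a strict preorder of distinguished monomorphisms, called inclusions,
on the objects of the category (the order is a field and not an instance of `PartialOrder`,
since the latter would give a second category structure). -/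
class SubobjectStructure (C : Type u) [Category.{v} C] where
  /-- `Sub a b` says that there is an inclusion from `a` to `b`. -/
  Sub : C → C → Prop
  sub_refl : ∀ a, Sub a a
  sub_trans : ∀ {a b c}, Sub a b → Sub b c → Sub a c
  sub_antisymm : ∀ {a b}, Sub a b → Sub b a → a = b
  /-- The unique inclusion from `a` to `b`. -/
  incl : ∀ {a b : C}, Sub a b → (a ⟶ b)
  incl_refl : ∀ a, incl (sub_refl a) = 𝟙 a
  incl_comp : ∀ {a b c} (h : Sub a b) (k : Sub b c), incl h ≫ incl k = incl (sub_trans h k)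
  incl_mono : ∀ {a b} (h : Sub a b), Mono (incl h)
  /-- If `h ≫ j` and `j` are inclusions, then `h` is an inclusion. -/
  incl_of_comp : ∀ {a b c} (h : a ⟶ b) (k : Sub b c) (l : Sub a c),
    h ≫ incl k = incl l → ∃ m : Sub a b, h = incl m

open SubobjectStructure

variable {C : Type u} [Category.{v} C] [SubobjectStructure C]

/-- A normal factorization of `f`: a retraction onto a subobject of the domain, followed by an
isomorphism, followed by an inclusion. -/
structure NormalFactorization {c d : C} (f : c ⟶ d) where
  coim : C
  im : C
  coim_sub : Sub coim c
  im_sub : Sub im d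
  retr : c ⟶ coim
  incl_retr : incl coim_sub ≫ retr = 𝟙 coim
  iso : coim ≅ im
  fac : retr ≫ iso.hom ≫ incl im_sub = f

variable (C) in
/-- A normal cone: an apex and a family of morphisms to the apex, compatible with inclusions, at
least one of which is an isomorphism. -/
@[ext]
structure NormalCone where
  apex : C
  comp : ∀ c : C, c ⟶ apex
  incl_comp : ∀ {a b : C} (h : Sub a b), incl h ≫ comp b = comp a
  exists_isIso : ∃ m : C, IsIso (comp m)

variable (C) in
/-- A normal category is a category with subobjects in which every inclusion splits, every
morphism has a normal factorization, and every object is the apex of a normal cone whose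
component at this object is the identity. -/
class IsNormalCategory : Prop where
  split : ∀ {a b : C} (h : Sub a b), ∃ r : b ⟶ a, incl h ≫ r = 𝟙 a
  factor : ∀ {a b : C} (f : a ⟶ b), Nonempty (NormalFactorization f)
  cone : ∀ c : C, ∃ (γ : NormalCone C) (h : γ.apex = c), γ.comp c ≫ eqToHom h = 𝟙 c

theorem sub_of_split {c d x y : C} {p : c ⟶ x} {q : c ⟶ y} (hx : Sub x d) (hy : Sub y d)
    (hp : ∃ s, s ≫ p = 𝟙 x) (h : p ≫ incl hx = q ≫ incl hy) : Sub x y := by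
  obtain ⟨s, hs⟩ := hp
  obtain ⟨m, -⟩ := incl_of_comp (s ≫ q) hy hx (by
    rw [Category.assoc, ← h, ← Category.assoc, hs, Category.id_comp])
  exact m

/-- Uniqueness of the factorization into a split epimorphism and an inclusion. -/
theorem split_epi_incl_unique {c d x y : C} {p : c ⟶ x} {q : c ⟶ y} (hx : Sub x d)
    (hy : Sub y d) (hp : ∃ s, s ≫ p = 𝟙 x) (hq : ∃ s, s ≫ q = 𝟙 y)
    (h : p ≫ incl hx = q ≫ incl hy) : ∃ e : x = y, p ≫ eqToHom e = q := by
  obtain rfl := sub_antisymm (sub_of_split hx hy hp h) (sub_of_split hy hx hq h.symm)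
  have := incl_mono hx
  refine ⟨rfl, ?_⟩
  rw [eqToHom_refl, Category.comp_id]
  exact (cancel_mono (incl hx)).1 h

theorem NormalCone.ext_of_incl {γ δ : NormalCone C} (h : γ.apex = δ.apex)
    (hc : ∀ a, γ.comp a ≫ eqToHom h = δ.comp a) : γ = δ := by
  obtain ⟨x, p, _, _⟩ := γ
  obtain ⟨y, q, _, _⟩ := δ
  obtain rfl : x = y := h
  obtain rfl : p = q := by
    funext a
    simpa using hc a
  rfl

variable [IsNormalCategory C]

/-- The image of a morphism (it does not depend on the chosen normal factorization, see
`split_epi_incl_unique`). -/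
noncomputable def image {c d : C} (f : c ⟶ d) : C :=
  (Classical.choice (IsNormalCategory.factor f)).im

theorem image_sub {c d : C} (f : c ⟶ d) : Sub (image f) d :=
  (Classical.choice (IsNormalCategory.factor f)).im_sub

/-- The epimorphic component `f°` of a morphism `f`: the composite of the retraction and of the
isomorphism in a normal factorization of `f`. -/
noncomputable def epiComp {c d : C} (f : c ⟶ d) : c ⟶ image f :=
  (Classical.choice (IsNormalCategory.factor f)).retr ≫
    (Classical.choice (IsNormalCategory.factor f)).iso.hom

theorem epiComp_incl {c d : C} (f : c ⟶ d) : epiComp f ≫ incl (image_sub f) = f := by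
  have := (Classical.choice (IsNormalCategory.factor f)).fac
  exact (Category.assoc _ _ _).trans this

theorem epiComp_split {c d : C} (f : c ⟶ d) : ∃ s : image f ⟶ c, s ≫ epiComp f = 𝟙 _ := by
  let F := Classical.choice (IsNormalCategory.factor f)
  refine ⟨F.iso.inv ≫ incl F.coim_sub, ?_⟩
  have h : (F.iso.inv ≫ incl F.coim_sub) ≫ F.retr ≫ F.iso.hom = 𝟙 F.im := by
    rw [Category.assoc, ← Category.assoc (incl _), F.incl_retr]
    simp
  exact h

namespace NormalCone

/-- The cone `γ * f°`, whose component at `a` is `γ(a)` followed by the epimorphic component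
of `f`. -/
noncomputable def star (γ : NormalCone C) {d : C} (f : γ.apex ⟶ d) : NormalCone C where
  apex := image f
  comp a := γ.comp a ≫ epiComp f
  incl_comp h := by rw [← Category.assoc, γ.incl_comp h]
  exists_isIso := by
    obtain ⟨m, hm⟩ := γ.exists_isIso
    obtain ⟨F⟩ := IsNormalCategory.factor (γ.comp m ≫ epiComp f)
    obtain ⟨s, hs⟩ := epiComp_split f
    obtain ⟨e, he⟩ := split_epi_incl_unique (p := F.retr ≫ F.iso.hom)
      (q := γ.comp m ≫ epiComp f) F.im_sub (sub_refl _)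
      ⟨F.iso.inv ≫ incl F.coim_sub, by
        rw [Category.assoc, ← Category.assoc (incl _), F.incl_retr]; simp⟩
      ⟨s ≫ inv (γ.comp m), by simp [hs]⟩
      (by rw [Category.assoc, F.fac, incl_refl, Category.comp_id])
    refine ⟨F.coim, ?_⟩
    have h : γ.comp F.coim ≫ epiComp f = F.iso.hom ≫ eqToHom e := by
      rw [← γ.incl_comp F.coim_sub, Category.assoc]
      refine (congrArg (incl F.coim_sub ≫ ·) he.symm).trans ?_
      rw [← Category.assoc, ← Category.assoc, F.incl_retr, Category.id_comp]
    rw [h]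
    infer_instance

/-- The product of normal cones: `γ · σ = γ * (σ(c))°`, where `c` is the apex of `γ`. -/
noncomputable instance : Mul (NormalCone C) := ⟨fun γ σ => γ.star (σ.comp γ.apex)⟩

theorem mul_def (γ σ : NormalCone C) : γ * σ = γ.star (σ.comp γ.apex) := rfl

/-- A cone `δ` with components `γ(a) ≫ q`, where `q` is the split epimorphism in a factorization of
`f`, is `γ * f°`. -/
theorem star_eq (γ δ : NormalCone C) {d : C} (f : γ.apex ⟶ d) (hd : Sub δ.apex d)
    (q : γ.apex ⟶ δ.apex) (hq : ∃ s, s ≫ q = 𝟙 _) (hf : q ≫ incl hd = f)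
    (hδ : ∀ a, γ.comp a ≫ q = δ.comp a) : γ.star f = δ := by
  obtain ⟨e, he⟩ := split_epi_incl_unique (image_sub f) hd (epiComp_split f) hq
    ((epiComp_incl f).trans hf.symm)
  refine ext_of_incl e fun a => ?_
  rw [← hδ, ← he]
  exact Category.assoc _ _ _

theorem star_star (γ : NormalCone C) {c d : C} (f : γ.apex ⟶ c) (g : c ⟶ d) :
    γ.star (f ≫ g) = (γ.star f).star (incl (image_sub f) ≫ g) := by
  obtain ⟨s, hs⟩ := epiComp_split f
  obtain ⟨t, ht⟩ := epiComp_split (incl (image_sub f) ≫ g)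
  refine star_eq _ _ _ (image_sub (incl (image_sub f) ≫ g))
    (epiComp f ≫ epiComp (incl (image_sub f) ≫ g)) ⟨t ≫ s, ?_⟩ ?_ fun a => ?_
  · have : (t ≫ s) ≫ epiComp f ≫ epiComp (incl (image_sub f) ≫ g) = 𝟙 _ := by
      rw [Category.assoc, ← Category.assoc s, hs, Category.id_comp, ht]
    exact this
  · have : (epiComp f ≫ epiComp (incl (image_sub f) ≫ g)) ≫ incl (image_sub _) = f ≫ g := by
      rw [Category.assoc, epiComp_incl, ← Category.assoc, epiComp_incl]
    exact this
  · exact (Category.assoc _ _ _).symm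

theorem star_incl (γ : NormalCone C) {c d : C} (f : γ.apex ⟶ c) (h : Sub c d) :
    γ.star (f ≫ incl h) = γ.star f :=
  star_eq _ _ _ (sub_trans (image_sub f) h) (epiComp f) (epiComp_split f)
    (by
      have : epiComp f ≫ incl (sub_trans (image_sub f) h) = f ≫ incl h := by
        rw [← SubobjectStructure.incl_comp (image_sub f) h, ← Category.assoc, epiComp_incl]
      exact this) fun _ => rfl

/-- The normal cones in a normal category form a semigroup. -/
noncomputable instance : Semigroup (NormalCone C) where
  mul_assoc γ σ τ := by
    have h1 : γ * (σ * τ) = γ.star (σ.comp γ.apex ≫ epiComp (τ.comp σ.apex)) := rfl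
    have h2 : γ * σ * τ = (γ.star (σ.comp γ.apex)).star (τ.comp (image (σ.comp γ.apex))) := rfl
    rw [h1, h2, ← star_incl γ _ (image_sub (τ.comp σ.apex)), Category.assoc, epiComp_incl,
      star_star]
    exact congrArg _ (τ.incl_comp (image_sub _)).symm

theorem star_injective (γ : NormalCone C) {c : C} {f g : γ.apex ⟶ c}
    (h : γ.star f = γ.star g) : f = g := by
  obtain ⟨m, hm⟩ := γ.exists_isIso
  have key : ∀ δ : NormalCone C, γ.star f = δ → ∃ k : Sub δ.apex c, δ.comp m ≫ incl k =
      γ.comp m ≫ f := by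
    rintro δ rfl
    exact ⟨image_sub f, (Category.assoc _ _ _).trans (congrArg _ (epiComp_incl f))⟩
  obtain ⟨k, hk⟩ := key _ h
  have h2 : (γ.star g).comp m ≫ incl k = γ.comp m ≫ g :=
    (Category.assoc _ _ _).trans (congrArg _ (epiComp_incl g))
  exact (cancel_epi (γ.comp m)).1 (hk.symm.trans h2)

end NormalCone

/-- The category of subsets of `X`, with all functions between them as morphisms. -/
structure SubsetCat (X : Type u) where
  carrier : Set X

instance (X : Type u) : Category.{u} (SubsetCat X) where
  Hom A B := A.carrier → B.carrier
  id _ := fun x => x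
  comp f g := fun x => g (f x)

namespace NormalCone

/-- The set `H(γ; c) = {γ * f° : f ∈ C(c_γ, c)}`, where `c_γ` is the apex of `γ`. -/
def hSet (γ : NormalCone C) (c : C) : Set (NormalCone C) :=
  {δ | ∃ f : γ.apex ⟶ c, δ = γ.star f}

/-- The map `H(γ; g)` from `H(γ; c)` to `H(γ; d)`, which sends `γ * f°` to `γ * (f g)°`
(the morphism `f` is unique, see `hMap_star`). -/
noncomputable def hMap (γ : NormalCone C) {c d : C} (g : c ⟶ d) (x : γ.hSet c) : γ.hSet d :=
  ⟨γ.star (x.2.choose ≫ g), _, rfl⟩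

theorem hMap_star (γ : NormalCone C) {c d : C} (g : c ⟶ d) (f : γ.apex ⟶ c) :
    γ.hMap g ⟨γ.star f, f, rfl⟩ = ⟨γ.star (f ≫ g), _, rfl⟩ := by
  have h : ∃ f' : γ.apex ⟶ c, γ.star f = γ.star f' := ⟨f, rfl⟩
  have : h.choose = f := (γ.star_injective h.choose_spec).symm
  exact Subtype.ext (congrArg (fun k => γ.star (k ≫ g)) this)

/-- The functor `H(γ; -)`, with values in the subsets of the set of normal cones. -/
noncomputable def hFunctor (γ : NormalCone C) : C ⥤ SubsetCat (NormalCone C) where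
  obj c := ⟨γ.hSet c⟩
  map g := γ.hMap g
  map_id c := by
    funext x
    obtain ⟨_, f, rfl⟩ := x
    refine (γ.hMap_star _ f).trans (Subtype.ext ?_)
    exact congrArg γ.star (Category.comp_id f)
  map_comp g k := by
    funext x
    obtain ⟨_, f, rfl⟩ := x
    refine (γ.hMap_star _ f).trans (Eq.trans ?_ (congrArg (γ.hMap k) (γ.hMap_star g f)).symm)
    refine Eq.trans (Subtype.ext ?_) (γ.hMap_star k (f ≫ g)).symm
    exact congrArg γ.star (Category.assoc f g k).symm

end NormalCone

variable (C) in
/-- The normal dual `N*C`: the full subcategory of the category of set-valued functors on `C` whose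
objects are the functors `H(ε; -)` for the idempotents `ε` of the semigroup of normal cones. -/
structure NormalDual where
  functor : C ⥤ SubsetCat (NormalCone C)
  exists_idem : ∃ ε : NormalCone C, IsIdempotentElem ε ∧ functor = ε.hFunctor

instance : Category (NormalDual C) where
  Hom F G := NatTrans F.functor G.functor
  id F := NatTrans.id F.functor
  comp α β := NatTrans.vcomp α β
  id_comp α := Category.id_comp (obj := C ⥤ SubsetCat (NormalCone C)) α
  comp_id α := Category.comp_id (obj := C ⥤ SubsetCat (NormalCone C)) α
  assoc α β γ := Category.assoc (obj := C ⥤ SubsetCat (NormalCone C)) α β γ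

namespace NormalDual

/-- `F` is a subfunctor of `G`. -/
def IsSubfunctor (F G : NormalDual C) : Prop :=
  ∃ h : ∀ c, (F.functor.obj c).carrier ⊆ (G.functor.obj c).carrier,
    ∀ {c d : C} (g : c ⟶ d) (x : (F.functor.obj c).carrier),
      (F.functor.map g x).1 = (G.functor.map g ⟨x.1, h c x.2⟩).1

/-- The inclusion of a subfunctor. -/
def subfunctorIncl {F G : NormalDual C} (h : IsSubfunctor F G) : F ⟶ G where
  app c := fun x => ⟨x.1, h.1 c x.2⟩
  naturality _ _ g := by
    funext x
    exact Subtype.ext (h.2 g x)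

theorem isSubfunctor_antisymm {F G : NormalDual C} (h : IsSubfunctor F G)
    (k : IsSubfunctor G F) : F = G := by
  obtain ⟨⟨o, m, _, _⟩, _⟩ := F
  obtain ⟨⟨o', m', _, _⟩, _⟩ := G
  have e : o = o' := by
    funext c
    have := Set.Subset.antisymm (h.1 c) (k.1 c)
    change (o c).carrier = (o' c).carrier at this
    cases hc : o c
    cases hc' : o' c
    simp_all
  subst e
  have e : @m = @m' := by
    funext c d g x
    exact Subtype.ext (h.2 g x)
  subst e
  rfl

/-- The inclusions of the normal dual are the inclusions of subfunctors. -/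
instance : SubobjectStructure (NormalDual C) where
  Sub := IsSubfunctor
  sub_refl _ := ⟨fun _ => subset_rfl, fun _ _ => rfl⟩
  sub_trans h k := ⟨fun c => (h.1 c).trans (k.1 c), fun g x => (h.2 g x).trans (k.2 g _)⟩
  sub_antisymm := isSubfunctor_antisymm
  incl := subfunctorIncl
  incl_refl _ := rfl
  incl_comp _ _ := rfl
  incl_mono h := ⟨fun α β e => by
    refine NatTrans.ext (funext fun c => funext fun x => Subtype.ext ?_)
    have hx := congrArg Subtype.val (congrFun (congrFun (congrArg NatTrans.app e) c) x)
    exact hx⟩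
  incl_of_comp {F G K} α k l e := by
    have key : ∀ c (x : (F.functor.obj c).carrier), (α.app c x).1 = x.1 := fun c x =>
      congrArg Subtype.val (congrFun (congrFun (congrArg NatTrans.app e) c) x)
    have hs : ∀ c, (F.functor.obj c).carrier ⊆ (G.functor.obj c).carrier := fun c x hx => by
      have := (α.app c ⟨x, hx⟩).2
      rwa [key] at this
    have hk : ∀ c (x : (F.functor.obj c).carrier), α.app c x = ⟨x.1, hs c x.2⟩ := fun c x =>
      Subtype.ext (key c x)
    refine ⟨⟨hs, fun {c d} g x => ?_⟩, ?_⟩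
    · rw [← hk, ← key]
      exact congrArg Subtype.val (congrFun (α.naturality g) x)
    · exact NatTrans.ext (funext fun c => funext fun x => hk c x)

end NormalDual

/-- An isomorphism of categories with subobjects (in particular, of normal categories): a pair of
mutually inverse functors that preserve inclusions. -/
structure NormalIso (C : Type*) [Category* C] [SubobjectStructure C] (D : Type*) [Category* D]
    [SubobjectStructure D] where
  functor : C ⥤ D
  inverse : D ⥤ C
  functor_inverse : functor ⋙ inverse = 𝟭 C
  inverse_functor : inverse ⋙ functor = 𝟭 D
  functor_incl : ∀ {a b : C} (h : Sub a b), ∃ k : Sub (functor.obj a) (functor.obj b),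
    functor.map (incl h) = incl k
  inverse_incl : ∀ {a b : D} (h : Sub a b), ∃ k : Sub (inverse.obj a) (inverse.obj b),
    inverse.map (incl h) = incl k

end NormalCategories

section Semigroups

/-- A regular semigroup. -/
class IsRegularSemigroup (S : Type u) [Semigroup S] : Prop where
  regular : ∀ a : S, ∃ b : S, a * b * a = a

/-- A Clifford semigroup is a semilattice of groups: it has a homomorphism onto a semilattice
each of whose fibres is a group. -/
class IsCliffordSemigroup (S : Type u) [Semigroup S] : Prop where
  exists_semilattice : ∃ (Y : Type u) (_ : SemilatticeInf Y) (φ : S → Y),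
    Function.Surjective φ ∧ (∀ a b, φ (a * b) = φ a ⊓ φ b) ∧
    ∀ y, ∃ e, φ e = y ∧ (∀ a, φ a = y → e * a = a ∧ a * e = a) ∧
      ∀ a, φ a = y → ∃ b, φ b = y ∧ a * b = e ∧ b * a = e

instance (S : Type u) [Semigroup S] [IsCliffordSemigroup S] : IsRegularSemigroup S where
  regular a := by
    obtain ⟨Y, _, φ, -, -, h⟩ := IsCliffordSemigroup.exists_semilattice (S := S)
    obtain ⟨e, -, he, hi⟩ := h (φ a)
    obtain ⟨b, -, hb, -⟩ := hi a rfl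
    exact ⟨b, by rw [hb, (he a rfl).1]⟩

variable (S : Type u) [Semigroup S]

/-- The objects of `L(S)`: the principal left ideals `Se` with `e` idempotent. -/
@[ext]
structure LCat where
  carrier : Set S
  principal : ∃ e : S, IsIdempotentElem e ∧ carrier = {x | ∃ s, x = s * e}

variable {S} in
/-- The map from `A = Se` to `B = Sf` is of the form `ρ(e, u, f)`, that is, it sends `x`
to `xu`, where `e` and `f` are idempotent and `u ∈ eSf`. -/
def IsRightTranslation {A B : LCat S} (φ : A.carrier → B.carrier) : Prop :=
  ∃ e u f : S, IsIdempotentElem e ∧ IsIdempotentElem f ∧ A.carrier = {x | ∃ s, x = s * e} ∧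
    B.carrier = {x | ∃ s, x = s * f} ∧ (∃ s, u = e * s * f) ∧ ∀ x, (φ x).1 = x.1 * u

namespace LCat

variable {S}

theorem isRightTranslation_of {A B : LCat S} (φ : A.carrier → B.carrier) (u : S)
    (h : ∀ x, (φ x).1 = x.1 * u) : IsRightTranslation φ := by
  obtain ⟨e, he, hA⟩ := A.principal
  obtain ⟨f, hf, hB⟩ := B.principal
  have heA : e ∈ A.carrier := by rw [hA]; exact ⟨e, he.symm⟩
  have hu : e * u ∈ B.carrier := by
    rw [← h ⟨e, heA⟩]
    exact (φ ⟨e, heA⟩).2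
  rw [hB] at hu
  obtain ⟨s, hs⟩ := hu
  refine ⟨e, e * u, f, he, hf, hA, hB, ⟨s, ?_⟩, fun x => ?_⟩
  · have : e * (e * u) = e * u := by rw [← mul_assoc, he.eq]
    rw [← this, hs, mul_assoc]
  · obtain ⟨t, ht⟩ := (Set.ext_iff.1 hA x.1).1 x.2
    rw [h, ht]
    rw [mul_assoc, mul_assoc, ← mul_assoc e e u, he.eq]

/-- The morphisms of `L(S)`: the maps `ρ(e, u, f)`, which are partial right translations. -/
instance : Category.{u} (LCat S) where
  Hom A B := {φ : A.carrier → B.carrier // IsRightTranslation φ}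
  id A := ⟨fun x => x, by
    obtain ⟨e, he, hA⟩ := A.principal
    refine isRightTranslation_of _ e fun x => ?_
    obtain ⟨t, ht⟩ := (Set.ext_iff.1 hA x.1).1 x.2
    rw [ht, mul_assoc, he.eq]⟩
  comp φ ψ := ⟨fun x => ψ.1 (φ.1 x), by
    obtain ⟨_, u, _, _, _, _, _, _, hu⟩ := φ.2
    obtain ⟨_, v, _, _, _, _, _, _, hv⟩ := ψ.2
    exact isRightTranslation_of _ (u * v) fun x => by rw [hv, hu]; simp only [mul_assoc]⟩

/-- The morphism given by multiplication by `u`. -/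
def homMk {A B : LCat S} (u : S) (h : ∀ x ∈ A.carrier, x * u ∈ B.carrier) : A ⟶ B :=
  ⟨fun x => ⟨x.1 * u, h x.1 x.2⟩, isRightTranslation_of _ u fun _ => rfl⟩

theorem hom_ext {A B : LCat S} {φ ψ : A ⟶ B} (h : ∀ x, (φ.1 x).1 = (ψ.1 x).1) : φ = ψ :=
  Subtype.ext (funext fun x => Subtype.ext (h x))

/-- The inclusions of `L(S)` are the inclusions of ideals. -/
instance : SubobjectStructure (LCat S) where
  Sub A B := A.carrier ⊆ B.carrier
  sub_refl _ := subset_rfl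
  sub_trans h k := h.trans k
  sub_antisymm h k := LCat.ext (h.antisymm k)
  incl {A _} h := ⟨fun x => ⟨x.1, h x.2⟩, by
    obtain ⟨_, u, _, _, _, _, _, _, hu⟩ := (𝟙 A : A ⟶ A).2
    exact isRightTranslation_of _ u hu⟩
  incl_refl _ := rfl
  incl_comp _ _ := rfl
  incl_mono h := ⟨fun φ ψ e => hom_ext fun x => by
    have hx := congrArg Subtype.val (congrFun (congrArg Subtype.val e) x)
    exact hx⟩
  incl_of_comp {A B D} φ k l e := by
    have key : ∀ x, (φ.1 x).1 = x.1 := fun x =>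
      congrArg Subtype.val (congrFun (congrArg Subtype.val e) x)
    exact ⟨fun x hx => by have := (φ.1 ⟨x, hx⟩).2; rwa [key] at this, hom_ext key⟩

/-- The object `Se`. -/
def ideal (e : S) (he : IsIdempotentElem e) : LCat S := ⟨{x | ∃ s, x = s * e}, e, he, rfl⟩

theorem mem_ideal {e : S} (he : IsIdempotentElem e) {x : S} :
    x ∈ (ideal e he).carrier ↔ x * e = x := by
  refine ⟨?_, fun h => ⟨x, h.symm⟩⟩
  rintro ⟨s, rfl⟩
  rw [mul_assoc, he.eq]

theorem exists_eq_ideal (A : LCat S) : ∃ (e : S) (he : IsIdempotentElem e), A = ideal e he := by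
  obtain ⟨e, he, hA⟩ := A.principal
  exact ⟨e, he, LCat.ext hA⟩

theorem exists_factorization [IsRegularSemigroup S] {A B : LCat S} (φ : A ⟶ B) :
    Nonempty (NormalFactorization φ) := by
  obtain ⟨e, u, f, he, hf, hA, hB, ⟨s, hs⟩, hφ⟩ := φ.2
  obtain rfl : A = ideal e he := LCat.ext hA
  obtain rfl : B = ideal f hf := LCat.ext hB
  obtain ⟨w, hw⟩ := IsRegularSemigroup.regular u
  have heu : e * u = u := by rw [hs]; simp only [← mul_assoc, he.eq]
  have huf : u * f = u := by rw [hs]; simp only [mul_assoc, hf.eq]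
  obtain ⟨z, hz⟩ : ∃ z, z = w * e := ⟨_, rfl⟩
  have huz : u * z * u = u := by
    rw [hz]
    calc _ = u * w * (e * u) := by simp only [mul_assoc]
      _ = u := by rw [heu]; simpa only [mul_assoc] using hw
  have hze : z * e = z := by rw [hz, mul_assoc, he.eq]
  have hg : IsIdempotentElem (u * z) := by
    change (u * z) * (u * z) = u * z
    calc _ = (u * z * u) * z := by simp only [mul_assoc]
      _ = _ := by rw [huz]
  have hh : IsIdempotentElem (z * u) := by
    change (z * u) * (z * u) = z * u
    calc _ = z * (u * z * u) := by simp only [mul_assoc]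
      _ = _ := by rw [huz]
  have hge : (u * z) * e = u * z := by
    calc _ = u * (z * e) := by simp only [mul_assoc]
      _ = _ := by rw [hze]
  have hhf : (z * u) * f = z * u := by
    calc _ = z * (u * f) := by simp only [mul_assoc]
      _ = _ := by rw [huf]
  have hgA : (ideal _ hg).carrier ⊆ (ideal e he).carrier := fun x hx => by
    rw [mem_ideal] at hx ⊢
    calc _ = (x * (u * z)) * e := by rw [hx]
      _ = x * ((u * z) * e) := by simp only [mul_assoc]
      _ = x := by rw [hge, hx]
  have hhB : (ideal _ hh).carrier ⊆ (ideal f hf).carrier := fun x hx => by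
    rw [mem_ideal] at hx ⊢
    calc _ = (x * (z * u)) * f := by rw [hx]
      _ = x * ((z * u) * f) := by simp only [mul_assoc]
      _ = x := by rw [hhf, hx]
  have hu : ∀ x ∈ (ideal _ hg).carrier, x * u ∈ (ideal _ hh).carrier := fun x _ => ⟨x * u, by
    calc x * u = x * (u * z * u) := by rw [huz]
      _ = _ := by simp only [mul_assoc]⟩
  have hz' : ∀ x ∈ (ideal _ hh).carrier, x * z ∈ (ideal _ hg).carrier := fun x hx => ⟨x * z, by
    have hx := (mem_ideal hh).1 hx
    calc x * z = (x * (z * u)) * z := by rw [hx]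
      _ = (x * z) * (u * z) := by simp only [mul_assoc]⟩
  refine ⟨{ coim := ideal _ hg, im := ideal _ hh, coim_sub := hgA, im_sub := hhB
            retr := homMk (u * z) fun x _ => ⟨x, rfl⟩
            incl_retr := hom_ext fun x => (mem_ideal hg).1 x.2
            iso := { hom := homMk u hu
                     inv := homMk z hz'
                     hom_inv_id := hom_ext fun x => ?_
                     inv_hom_id := hom_ext fun x => ?_ }
            fac := hom_ext fun x => ?_ }⟩
  · refine Eq.trans ?_ ((mem_ideal hg).1 x.2)
    change (x.1 * u) * z = x.1 * (u * z)
    simp only [mul_assoc]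
  · refine Eq.trans ?_ ((mem_ideal hh).1 x.2)
    change (x.1 * z) * u = x.1 * (z * u)
    simp only [mul_assoc]
  · rw [hφ]
    change (x.1 * (u * z)) * u = x.1 * u
    calc _ = x.1 * (u * z * u) := by simp only [mul_assoc]
      _ = _ := by rw [huz]

/-- For a regular semigroup `S`, the category `L(S)` is normal. -/
instance [IsRegularSemigroup S] : IsNormalCategory (LCat S) where
  split {A _} h := by
    obtain ⟨e, he, rfl⟩ := exists_eq_ideal A
    exact ⟨homMk e fun x _ => ⟨x, rfl⟩, hom_ext fun x => (mem_ideal he).1 x.2⟩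
  factor := exists_factorization
  cone A := by
    obtain ⟨e, he, rfl⟩ := exists_eq_ideal A
    have hid : homMk (A := ideal e he) (B := ideal e he) e (fun x _ => ⟨x, rfl⟩) = 𝟙 _ :=
      hom_ext fun x => (mem_ideal he).1 x.2
    refine ⟨{ apex := ideal e he
              comp := fun B => homMk e fun x _ => ⟨x, rfl⟩
              incl_comp := fun _ => rfl
              exists_isIso := ⟨ideal e he, ?_⟩ }, rfl, ?_⟩
    · rw [hid]
      infer_instance
    · exact (Category.comp_id _).trans hid

end LCat

/-- The objects of `R(S)`: the principal right ideals `eS` with `e` idempotent. -/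
@[ext]
structure RCat where
  carrier : Set S
  principal : ∃ e : S, IsIdempotentElem e ∧ carrier = {x | ∃ s, x = e * s}

variable {S} in
/-- The map from `A = eS` to `B = fS` is of the form `λ(e, u, f)`, that is, it sends `x`
to `ux`, where `e` and `f` are idempotent and `u ∈ fSe`. -/
def IsLeftTranslation {A B : RCat S} (φ : A.carrier → B.carrier) : Prop :=
  ∃ e u f : S, IsIdempotentElem e ∧ IsIdempotentElem f ∧ A.carrier = {x | ∃ s, x = e * s} ∧
    B.carrier = {x | ∃ s, x = f * s} ∧ (∃ s, u = f * s * e) ∧ ∀ x, (φ x).1 = u * x.1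

namespace RCat

variable {S}

theorem isLeftTranslation_of {A B : RCat S} (φ : A.carrier → B.carrier) (u : S)
    (h : ∀ x, (φ x).1 = u * x.1) : IsLeftTranslation φ := by
  obtain ⟨e, he, hA⟩ := A.principal
  obtain ⟨f, hf, hB⟩ := B.principal
  have heA : e ∈ A.carrier := by rw [hA]; exact ⟨e, he.symm⟩
  have hu : u * e ∈ B.carrier := by
    rw [← h ⟨e, heA⟩]
    exact (φ ⟨e, heA⟩).2
  rw [hB] at hu
  obtain ⟨s, hs⟩ := hu
  refine ⟨e, u * e, f, he, hf, hA, hB, ⟨s, ?_⟩, fun x => ?_⟩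
  · have : (u * e) * e = u * e := by rw [mul_assoc, he.eq]
    rw [← this, hs]
  · obtain ⟨t, ht⟩ := (Set.ext_iff.1 hA x.1).1 x.2
    rw [h, ht]
    rw [← mul_assoc, ← mul_assoc, mul_assoc u e e, he.eq]

/-- The morphisms of `R(S)`: the maps `λ(e, u, f)`, which are partial left translations. -/
instance : Category.{u} (RCat S) where
  Hom A B := {φ : A.carrier → B.carrier // IsLeftTranslation φ}
  id A := ⟨fun x => x, by
    obtain ⟨e, he, hA⟩ := A.principal
    refine isLeftTranslation_of _ e fun x => ?_
    obtain ⟨t, ht⟩ := (Set.ext_iff.1 hA x.1).1 x.2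
    rw [ht, ← mul_assoc, he.eq]⟩
  comp φ ψ := ⟨fun x => ψ.1 (φ.1 x), by
    obtain ⟨_, u, _, _, _, _, _, _, hu⟩ := φ.2
    obtain ⟨_, v, _, _, _, _, _, _, hv⟩ := ψ.2
    exact isLeftTranslation_of _ (v * u) fun x => by rw [hv, hu]; simp only [mul_assoc]⟩

/-- The morphism given by multiplication by `u`. -/
def homMk {A B : RCat S} (u : S) (h : ∀ x ∈ A.carrier, u * x ∈ B.carrier) : A ⟶ B :=
  ⟨fun x => ⟨u * x.1, h x.1 x.2⟩, isLeftTranslation_of _ u fun _ => rfl⟩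

theorem hom_ext {A B : RCat S} {φ ψ : A ⟶ B} (h : ∀ x, (φ.1 x).1 = (ψ.1 x).1) : φ = ψ :=
  Subtype.ext (funext fun x => Subtype.ext (h x))

/-- The inclusions of `R(S)` are the inclusions of ideals. -/
instance : SubobjectStructure (RCat S) where
  Sub A B := A.carrier ⊆ B.carrier
  sub_refl _ := subset_rfl
  sub_trans h k := h.trans k
  sub_antisymm h k := RCat.ext (h.antisymm k)
  incl {A _} h := ⟨fun x => ⟨x.1, h x.2⟩, by
    obtain ⟨_, u, _, _, _, _, _, _, hu⟩ := (𝟙 A : A ⟶ A).2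
    exact isLeftTranslation_of _ u hu⟩
  incl_refl _ := rfl
  incl_comp _ _ := rfl
  incl_mono h := ⟨fun φ ψ e => hom_ext fun x => by
    have hx := congrArg Subtype.val (congrFun (congrArg Subtype.val e) x)
    exact hx⟩
  incl_of_comp {A B D} φ k l e := by
    have key : ∀ x, (φ.1 x).1 = x.1 := fun x =>
      congrArg Subtype.val (congrFun (congrArg Subtype.val e) x)
    exact ⟨fun x hx => by have := (φ.1 ⟨x, hx⟩).2; rwa [key] at this, hom_ext key⟩

/-- The object `eS`. -/
def ideal (e : S) (he : IsIdempotentElem e) : RCat S := ⟨{x | ∃ s, x = e * s}, e, he, rfl⟩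

theorem mem_ideal {e : S} (he : IsIdempotentElem e) {x : S} :
    x ∈ (ideal e he).carrier ↔ e * x = x := by
  refine ⟨?_, fun h => ⟨x, h.symm⟩⟩
  rintro ⟨s, rfl⟩
  rw [← mul_assoc, he.eq]

theorem exists_eq_ideal (A : RCat S) : ∃ (e : S) (he : IsIdempotentElem e), A = ideal e he := by
  obtain ⟨e, he, hA⟩ := A.principal
  exact ⟨e, he, RCat.ext hA⟩

theorem exists_factorization [IsRegularSemigroup S] {A B : RCat S} (φ : A ⟶ B) :
    Nonempty (NormalFactorization φ) := by
  obtain ⟨e, u, f, he, hf, hA, hB, ⟨s, hs⟩, hφ⟩ := φ.2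
  obtain rfl : A = ideal e he := RCat.ext hA
  obtain rfl : B = ideal f hf := RCat.ext hB
  obtain ⟨w, hw⟩ := IsRegularSemigroup.regular u
  have heu : u * e = u := by rw [hs]; simp only [mul_assoc, he.eq]
  have huf : f * u = u := by rw [hs]; simp only [← mul_assoc, hf.eq]
  obtain ⟨z, hz⟩ : ∃ z, z = e * w := ⟨_, rfl⟩
  have huz : u * z * u = u := by
    rw [hz]
    calc _ = (u * e) * w * u := by simp only [mul_assoc]
      _ = u := by rw [heu]; simpa only [mul_assoc] using hw
  have hze : e * z = z := by rw [hz, ← mul_assoc, he.eq]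
  have hg : IsIdempotentElem (z * u) := by
    change (z * u) * (z * u) = z * u
    calc _ = z * (u * z * u) := by simp only [mul_assoc]
      _ = _ := by rw [huz]
  have hh : IsIdempotentElem (u * z) := by
    change (u * z) * (u * z) = u * z
    calc _ = (u * z * u) * z := by simp only [mul_assoc]
      _ = _ := by rw [huz]
  have hge : e * (z * u) = z * u := by
    calc _ = (e * z) * u := by simp only [mul_assoc]
      _ = _ := by rw [hze]
  have hhf : f * (u * z) = u * z := by
    calc _ = (f * u) * z := by simp only [mul_assoc]
      _ = _ := by rw [huf]
  have hgA : (ideal _ hg).carrier ⊆ (ideal e he).carrier := fun x hx => by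
    rw [mem_ideal] at hx ⊢
    calc _ = e * ((z * u) * x) := by rw [hx]
      _ = (e * (z * u)) * x := by simp only [mul_assoc]
      _ = x := by rw [hge, hx]
  have hhB : (ideal _ hh).carrier ⊆ (ideal f hf).carrier := fun x hx => by
    rw [mem_ideal] at hx ⊢
    calc _ = f * ((u * z) * x) := by rw [hx]
      _ = (f * (u * z)) * x := by simp only [mul_assoc]
      _ = x := by rw [hhf, hx]
  have hu : ∀ x ∈ (ideal _ hg).carrier, u * x ∈ (ideal _ hh).carrier := fun x _ => ⟨u * x, by
    calc u * x = (u * z * u) * x := by rw [huz]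
      _ = _ := by simp only [mul_assoc]⟩
  have hz' : ∀ x ∈ (ideal _ hh).carrier, z * x ∈ (ideal _ hg).carrier := fun x hx => ⟨z * x, by
    have hx := (mem_ideal hh).1 hx
    calc z * x = z * ((u * z) * x) := by rw [hx]
      _ = (z * u) * (z * x) := by simp only [mul_assoc]⟩
  refine ⟨{ coim := ideal _ hg, im := ideal _ hh, coim_sub := hgA, im_sub := hhB
            retr := homMk (z * u) fun x _ => ⟨x, rfl⟩
            incl_retr := hom_ext fun x => (mem_ideal hg).1 x.2
            iso := { hom := homMk u hu
                     inv := homMk z hz'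
                     hom_inv_id := hom_ext fun x => ?_
                     inv_hom_id := hom_ext fun x => ?_ }
            fac := hom_ext fun x => ?_ }⟩
  · refine Eq.trans ?_ ((mem_ideal hg).1 x.2)
    change z * (u * x.1) = (z * u) * x.1
    simp only [mul_assoc]
  · refine Eq.trans ?_ ((mem_ideal hh).1 x.2)
    change u * (z * x.1) = (u * z) * x.1
    simp only [mul_assoc]
  · rw [hφ]
    change u * ((z * u) * x.1) = u * x.1
    calc _ = (u * z * u) * x.1 := by simp only [mul_assoc]
      _ = _ := by rw [huz]

/-- For a regular semigroup `S`, the category `R(S)` is normal. -/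
instance [IsRegularSemigroup S] : IsNormalCategory (RCat S) where
  split {A _} h := by
    obtain ⟨e, he, rfl⟩ := exists_eq_ideal A
    exact ⟨homMk e fun x _ => ⟨x, rfl⟩, hom_ext fun x => (mem_ideal he).1 x.2⟩
  factor := exists_factorization
  cone A := by
    obtain ⟨e, he, rfl⟩ := exists_eq_ideal A
    have hid : homMk (A := ideal e he) (B := ideal e he) e (fun x _ => ⟨x, rfl⟩) = 𝟙 _ :=
      hom_ext fun x => (mem_ideal he).1 x.2
    refine ⟨{ apex := ideal e he
              comp := fun B => homMk e fun x _ => ⟨x, rfl⟩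
              incl_comp := fun _ => rfl
              exists_isIso := ⟨ideal e he, ?_⟩ }, rfl, ?_⟩
    · rw [hid]
      infer_instance
    · exact (Category.comp_id _).trans hid

end RCat

end Semigroups

end CrossConnection

/-!
Let `S` be a Clifford semigroup. Every `u : S` gives a normal cone `principalCone u` in `R(S)`, with
apex the right ideal `uS` and with components `x ↦ u * x`. All normal cones are of this form
(`principalCone_surjective`). Indeed, the idempotents of a Clifford semigroup are central, so
isomorphic ideals `eS` and `dS` are equal; hence a normal cone `γ` with apex `dS` has an invertible
component at `dS` itself, which is left multiplication by some `u` in the group of units of `dSd`.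
For an element `x` of an object `A`, the compatibility of `γ` with the inclusions of `dxS` in `A` and
in `dS`, together with the centrality of `d`, shows that `γ(A)` sends `x` to `u * x` as well. Since
`principalCone u * f°` is `principalCone (f u)` (`principalCone_star`), products of cones correspond
to reversed products in `S`.

Under this identification `H(e; -)`, for an idempotent `e` of `S`, becomes the functor
`A ↦ A ∩ Se` on which the morphisms of `R(S)` act as they do on the ideals `A` themselves
(`dualFunctor_ideal`). It depends only on the left ideal `Se`, and it recovers `Se` as the union of
its values. By the argument of the Yoneda lemma, evaluated at `e ∈ eS ∩ Se`, a natural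
transformation between two such functors is right multiplication by an element of `S`
(`exists_app_eq_mul`), hence a morphism of `L(S)`; on both sides the inclusions are the morphisms
that act as the identity on elements.
-/

namespace CrossConnection

open SubobjectStructure

universe u

/-! ### Clifford semigroups -/

section Clifford

variable {S : Type u} [Semigroup S] [IsCliffordSemigroup S]

/-- The idempotents of a Clifford semigroup are central. -/
theorem idempotent_mul_comm {e : S} (he : IsIdempotentElem e) (a : S) :
    e * a = a * e := by
  obtain ⟨Y, _, φ, -, hφ, h⟩ := IsCliffordSemigroup.exists_semilattice (S := S)
  -- `f` is the identity of the fibre that contains both `e * a` and `a * e`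
  obtain ⟨f, hf, hid, hinv⟩ := h (φ e ⊓ φ a)
  have hfe : φ (f * e) = φ e ⊓ φ a := by rw [hφ, hf, inf_right_comm, inf_idem]
  have hef : φ (e * f) = φ e ⊓ φ a := by rw [hφ, hf, ← inf_assoc, inf_idem]
  have hfa : φ (f * a) = φ e ⊓ φ a := by rw [hφ, hf, inf_assoc, inf_idem]
  have haf : φ (a * f) = φ e ⊓ φ a := by rw [hφ, hf, inf_left_comm, inf_idem]
  have hea : φ (e * a) = φ e ⊓ φ a := hφ e a
  have hae : φ (a * e) = φ e ⊓ φ a := by rw [hφ, inf_comm]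
  -- an idempotent of the fibre is its identity
  have idem : ∀ x, φ x = φ e ⊓ φ a → x * x = x → x = f := fun x hx hxx => by
    obtain ⟨y, -, hxy, -⟩ := hinv x hx
    calc x = x * f := (hid x hx).2.symm
      _ = (x * x) * y := by rw [← hxy, mul_assoc]
      _ = f := by rw [hxx, hxy]
  have h1 : e * f = f := idem _ hef <| by
    calc (e * f) * (e * f) = e * (f * (e * f)) := mul_assoc _ _ _
      _ = (e * e) * f := by rw [(hid _ hef).1, mul_assoc]
      _ = e * f := by rw [he.eq]
  have h2 : f * e = f := idem _ hfe <| by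
    calc (f * e) * (f * e) = ((f * e) * f) * e := by simp only [mul_assoc]
      _ = f * (e * e) := by rw [(hid _ hfe).2, mul_assoc]
      _ = f * e := by rw [he.eq]
  calc e * a = f * (e * a) := (hid _ hea).1.symm
    _ = f * a := by rw [← mul_assoc, h2]
    _ = f * a * f := (hid _ hfa).2.symm
    _ = a * f := by rw [mul_assoc, (hid _ haf).1]
    _ = a * e * f := by rw [mul_assoc, h1]
    _ = a * e := (hid _ hae).2

/-- Every element of a Clifford semigroup lies in a subgroup. -/
theorem exists_group_inverse (a : S) :
    ∃ b : S, IsIdempotentElem (a * b) ∧ b * a = a * b ∧ (a * b) * a = a := by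
  obtain ⟨Y, _, φ, -, -, h⟩ := IsCliffordSemigroup.exists_semilattice (S := S)
  obtain ⟨e, hφe, hid, hinv⟩ := h (φ a)
  obtain ⟨b, -, hab, hba⟩ := hinv a rfl
  refine ⟨b, ?_, hba.trans hab.symm, ?_⟩
  · rw [hab]
    exact (hid e hφe).1
  · rw [hab]
    exact (hid a rfl).1

end Clifford

/-! ### Principal right ideals and morphisms between them -/

namespace RCat

variable {S : Type u} [Semigroup S]

theorem exists_map_eq_mul {A B : RCat S} (f : A ⟶ B) : ∃ u : S, ∀ x, (f.1 x).1 = u * x.1 := by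
  obtain ⟨_, u, _, _, _, _, _, _, hu⟩ := f.2
  exact ⟨u, hu⟩

theorem mul_mem {A : RCat S} {x : S} (hx : x ∈ A.carrier) (y : S) : x * y ∈ A.carrier := by
  obtain ⟨e, he, rfl⟩ := exists_eq_ideal A
  rw [mem_ideal] at hx ⊢
  rw [← mul_assoc, hx]

theorem eqToHom_apply {A B : RCat S} (h : A = B) (x : A.carrier) :
    ((eqToHom h : A ⟶ B).1 x).1 = x.1 := by
  subst h
  rfl

theorem normalCone_ext {γ δ : NormalCone (RCat S)} (h : γ.apex = δ.apex)
    (hc : ∀ A (x : A.carrier), ((γ.comp A).1 x).1 = ((δ.comp A).1 x).1) : γ = δ :=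
  NormalCone.ext_of_incl h fun A => hom_ext fun x => (eqToHom_apply h _).trans (hc A x)

variable [IsRegularSemigroup S]

/-- The right ideal `uS` generated by an arbitrary element `u` of a regular semigroup. -/
def gen (u : S) : RCat S where
  carrier := {x | ∃ s, x = u * s}
  principal := by
    obtain ⟨b, hb⟩ := IsRegularSemigroup.regular u
    refine ⟨u * b, ?_, Set.ext fun x => ⟨?_, ?_⟩⟩
    · change (u * b) * (u * b) = u * b
      rw [← mul_assoc, hb]
    · rintro ⟨s, rfl⟩
      exact ⟨u * s, by rw [← mul_assoc, hb]⟩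
    · rintro ⟨s, rfl⟩
      exact ⟨b * s, mul_assoc _ _ _⟩

theorem self_mem_gen (u : S) : u ∈ (gen u).carrier := by
  obtain ⟨b, hb⟩ := IsRegularSemigroup.regular u
  exact ⟨b * u, by rw [← mul_assoc, hb]⟩

/-- The morphism from `eS` to `A` that sends `e` to `s ∈ A`. -/
theorem exists_hom_gen {A : RCat S} {e s : S} (hs : s ∈ A.carrier)
    (hse : s * e = s) : ∃ f : gen e ⟶ A, (f.1 ⟨e, self_mem_gen e⟩).1 = s :=
  ⟨homMk s fun x _ => mul_mem hs x, hse⟩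

end RCat

/-! ### The normal cones in the category of principal right ideals -/

section Cones

open RCat

variable {S : Type u} [Semigroup S] [IsCliffordSemigroup S]

/-- The normal cone given by left multiplication by `u`, with apex `uS`. -/
def principalCone (u : S) : NormalCone (RCat S) where
  apex := gen u
  comp A := homMk u fun x _ => ⟨x, rfl⟩
  incl_comp _ := rfl
  exists_isIso := by
    obtain ⟨b, -, hb, hu⟩ := exists_group_inverse u
    have key : ∀ x : (gen u).carrier, u * b * x.1 = x.1 := by
      rintro ⟨_, s, rfl⟩
      change u * b * (u * s) = u * s
      rw [← mul_assoc, hu]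
    refine ⟨gen u, ⟨homMk b ?_, hom_ext fun x => ?_, hom_ext fun x => ?_⟩⟩
    · rintro _ ⟨s, rfl⟩
      exact ⟨b * s, by rw [← mul_assoc, hb, mul_assoc]⟩
    · change b * (u * x.1) = x.1
      rw [← mul_assoc, hb, key]
    · change u * (b * x.1) = x.1
      rw [← mul_assoc, key]

theorem principalCone_injective : Function.Injective (principalCone (S := S)) := by
  intro u v h
  have hc : ∀ γ δ : NormalCone (RCat S), γ = δ →
      ∀ A (x : A.carrier), ((γ.comp A).1 x).1 = ((δ.comp A).1 x).1 := by
    rintro γ _ rfl A x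
    rfl
  have hv : v ∈ (gen u).carrier := by
    rw [show gen u = gen v from congrArg NormalCone.apex h]
    exact self_mem_gen v
  obtain ⟨s, hs⟩ := hv
  obtain ⟨b, hb, -, hu⟩ := exists_group_inverse u
  have huv : u * (u * b) = v * (u * b) :=
    hc _ _ h (gen (u * b)) ⟨u * b, self_mem_gen _⟩
  rwa [← idempotent_mul_comm hb, ← idempotent_mul_comm hb, hu, hs, ← mul_assoc, hu, ← hs] at huv

/-- Isomorphic principal right ideals of a Clifford semigroup are equal. -/
theorem RCat.eq_of_iso {A B : RCat S} (i : A ≅ B) : A = B := by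
  -- by symmetry it is enough to prove one inclusion
  have key : ∀ {A B : RCat S}, (A ≅ B) → A.carrier ⊆ B.carrier := by
    intro A B i x hx
    obtain ⟨d, hd, rfl⟩ := exists_eq_ideal B
    obtain ⟨v, hv⟩ := exists_map_eq_mul i.inv
    have h1 : (i.inv.1 (i.hom.1 ⟨x, hx⟩)).1 = x :=
      congrArg Subtype.val (congrFun (congrArg Subtype.val i.hom_inv_id) ⟨x, hx⟩)
    have h2 := (mem_ideal hd).1 (i.hom.1 ⟨x, hx⟩).2
    rw [hv] at h1
    rw [mem_ideal, ← h1, ← mul_assoc, idempotent_mul_comm hd, mul_assoc, h2]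
  exact RCat.ext ((key i).antisymm (key i.symm))

/-- Every normal cone in `R(S)` is given by left multiplication by an element of `S`. -/
theorem principalCone_surjective : Function.Surjective (principalCone (S := S)) := by
  intro γ
  obtain ⟨m, hm⟩ := γ.exists_isIso
  obtain rfl := RCat.eq_of_iso (asIso (γ.comp m))
  obtain ⟨d, hd, hA⟩ := exists_eq_ideal γ.apex
  obtain ⟨w, hw⟩ := exists_map_eq_mul (γ.comp γ.apex)
  obtain ⟨v, hv⟩ := exists_map_eq_mul (inv (γ.comp γ.apex))
  have hdA : d ∈ γ.apex.carrier := by rw [hA, mem_ideal]; exact hd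
  have mem : ∀ {x}, x ∈ γ.apex.carrier ↔ d * x = x := by
    intro x
    rw [hA, mem_ideal]
  have hwd : w * d ∈ γ.apex.carrier := by
    rw [← hw ⟨d, hdA⟩]
    exact Subtype.prop _
  refine ⟨w * d, normalCone_ext (RCat.ext (Set.ext fun x => ⟨?_, fun hx => ?_⟩)) fun A x => ?_⟩
  · rintro ⟨s, rfl⟩
    exact mul_mem hwd s
  · -- `x` is the image under `γ(dS)` of its preimage `v * x`
    have h1 : ((γ.comp γ.apex).1 ((inv (γ.comp γ.apex)).1 ⟨x, hx⟩)).1 = x :=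
      congrArg Subtype.val (congrFun (congrArg Subtype.val
        (IsIso.inv_hom_id (γ.comp γ.apex))) ⟨x, hx⟩)
    have h2 := mem.1 ((inv (γ.comp γ.apex)).1 ⟨x, hx⟩).2
    rw [hw, hv] at h1
    rw [hv] at h2
    exact ⟨v * x, by rw [mul_assoc, h2, h1]⟩
  · change w * d * x.1 = _
    obtain ⟨t, ht⟩ := exists_map_eq_mul (γ.comp A)
    -- the cone is compatible with the inclusions of the ideal `dxS` in `A` and in the apex
    have hxA : (gen (d * x.1)).carrier ⊆ A.carrier := by
      rintro _ ⟨s, rfl⟩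
      rw [idempotent_mul_comm hd]
      exact mul_mem (mul_mem x.2 d) s
    have hxd : (gen (d * x.1)).carrier ⊆ γ.apex.carrier := by
      rintro _ ⟨s, rfl⟩
      exact mul_mem (mul_mem hdA _) s
    have h := (γ.incl_comp (a := gen (d * x.1)) (b := A) hxA).trans
      (γ.incl_comp (b := γ.apex) hxd).symm
    have h1 := congrArg Subtype.val
      (congrFun (congrArg Subtype.val h) ⟨d * x.1, self_mem_gen _⟩)
    have h2 : t * (d * x.1) = w * (d * x.1) := ((ht _).symm.trans h1).trans (hw _)
    have h3 := mem.1 ((γ.comp A).1 x).2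
    rw [ht] at h3 ⊢
    rw [mul_assoc, ← h2, ← mul_assoc, ← idempotent_mul_comm hd, mul_assoc, h3]

/-- In terms of elements of `S`, the cone `γ * f°` is obtained by applying `f`. -/
theorem principalCone_star (u : S) {A : RCat S} (f : (principalCone u).apex ⟶ A) :
    (principalCone u).star f = principalCone (f.1 ⟨u, self_mem_gen u⟩).1 := by
  obtain ⟨t, ht⟩ := exists_map_eq_mul f
  obtain ⟨w, hw⟩ : ∃ w, w = (f.1 ⟨u, self_mem_gen u⟩).1 := ⟨_, rfl⟩
  have htu : w = t * u := hw.trans (ht _)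
  have hwA : w ∈ A.carrier := hw ▸ Subtype.prop _
  obtain ⟨b, hb⟩ := IsRegularSemigroup.regular w
  rw [← hw]
  refine NormalCone.star_eq _ (principalCone w) f (fun x => ?_) (homMk t ?_)
    -- a section of `x ↦ t * x` from `uS` onto `wS`, where `w = t * u`
    ⟨homMk (u * b) fun x _ => ⟨b * x, mul_assoc _ _ _⟩, hom_ext ?_⟩
    (hom_ext fun x => (ht x).symm) fun B => hom_ext fun x => ?_
  · rintro ⟨s, rfl⟩
    exact mul_mem hwA s
  · rintro _ ⟨s, rfl⟩
    exact ⟨s, by rw [htu, mul_assoc]⟩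
  · rintro ⟨_, s, rfl⟩
    change t * (u * b * (w * s)) = w * s
    calc _ = t * u * b * w * s := by simp only [mul_assoc]
      _ = w * s := by rw [← htu, hb]
  · change t * (u * x.1) = w * x.1
    rw [htu, mul_assoc]

theorem principalCone_mul (u v : S) :
    principalCone u * principalCone v = principalCone (v * u) :=
  principalCone_star u ((principalCone v).comp (gen u))

/-- The normal cones in `R(S)` are in bijection with the elements of `S`. -/
noncomputable def coneEquiv : S ≃ NormalCone (RCat S) :=
  Equiv.ofBijective principalCone ⟨principalCone_injective, principalCone_surjective⟩

variable (S) in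
/-- The semigroup of normal cones in `R(S)` is anti-isomorphic to `S`. -/
noncomputable def coneMulEquiv : NormalCone (RCat S) ≃* Sᵐᵒᵖ :=
  MulEquiv.symm
    { toEquiv := MulOpposite.opEquiv.symm.trans coneEquiv
      map_mul' := fun u v => (principalCone_mul u.unop v.unop).symm }

end Cones

/-! ### The normal dual -/

section Dual

open RCat

variable {S : Type u} [Semigroup S]

theorem LCat.mul_mem {A : LCat S} {x : S} (hx : x ∈ A.carrier) (y : S) : y * x ∈ A.carrier := by
  obtain ⟨e, he, rfl⟩ := LCat.exists_eq_ideal A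
  rw [LCat.mem_ideal] at hx ⊢
  rw [mul_assoc, hx]

theorem LCat.heq_of_apply {A B A' B' : LCat S} (hA : A = A') (hB : B = B') {f : A ⟶ B}
    {g : A' ⟶ B'} (h : ∀ x (hx : x ∈ A.carrier) (hx' : x ∈ A'.carrier),
      (f.1 ⟨x, hx⟩).1 = (g.1 ⟨x, hx'⟩).1) : HEq f g := by
  subst hA hB
  exact heq_of_eq (LCat.hom_ext fun x => h x.1 x.2 x.2)

theorem RCat.map_mem {A : LCat S} {c d : RCat S} (g : c ⟶ d) (x : c.carrier)
    (hx : x.1 ∈ A.carrier) : (g.1 x).1 ∈ A.carrier := by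
  obtain ⟨u, hu⟩ := RCat.exists_map_eq_mul g
  rw [hu]
  exact LCat.mul_mem hx u

theorem LCat.map_mem {A B : LCat S} (f : A ⟶ B) {c : RCat S} (x : A.carrier)
    (hx : x.1 ∈ c.carrier) : (f.1 x).1 ∈ c.carrier := by
  obtain ⟨_, u, _, _, _, _, _, _, hu⟩ := f.2
  rw [hu]
  exact RCat.mul_mem hx u

theorem subsetFunctor_ext {C : Type*} [Category* C] {X : Type*} {F G : C ⥤ SubsetCat X}
    (h : ∀ c, (F.obj c).carrier = (G.obj c).carrier)
    (hm : ∀ {c d : C} (g : c ⟶ d) x (hx : x ∈ (F.obj c).carrier) (hx' : x ∈ (G.obj c).carrier),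
      (F.map g ⟨x, hx⟩).1 = (G.map g ⟨x, hx'⟩).1) : F = G := by
  obtain ⟨o, m, _, _⟩ := F
  obtain ⟨o', m', _, _⟩ := G
  obtain rfl : o = o' := by
    funext c
    have := h c
    change (o c).carrier = (o' c).carrier at this
    cases hc : o c
    cases hc' : o' c
    simp_all
  obtain rfl : @m = @m' := by
    funext c d g x
    exact Subtype.ext (hm g x.1 x.2 x.2)
  rfl

variable [IsCliffordSemigroup S]

/-- The functor `c ↦ A ∩ c` on `R(S)` attached to a left ideal `A`, where the elements of `S` are
identified with normal cones. -/
noncomputable def dualFunctor (A : LCat S) : RCat S ⥤ SubsetCat (NormalCone (RCat S)) where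
  obj c := ⟨{δ | coneEquiv.symm δ ∈ A.carrier ∧ coneEquiv.symm δ ∈ c.carrier}⟩
  map g := fun δ => ⟨coneEquiv (g.1 ⟨coneEquiv.symm δ.1, δ.2.2⟩).1, by
    change coneEquiv.symm _ ∈ A.carrier ∧ coneEquiv.symm _ ∈ _
    rw [Equiv.symm_apply_apply]
    exact ⟨RCat.map_mem g _ δ.2.1, Subtype.prop _⟩⟩
  map_id c := funext fun δ => Subtype.ext (coneEquiv.apply_symm_apply δ.1)
  map_comp g k := funext fun δ => Subtype.ext <| congrArg coneEquiv <|
    congrArg (fun y => (k.1 y).1) (Subtype.ext (coneEquiv.symm_apply_apply _).symm)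

/-- For an idempotent `e`, the functor of the left ideal `Se` is `H(e; -)`. -/
theorem dualFunctor_ideal {e : S} (he : IsIdempotentElem e) :
    dualFunctor (LCat.ideal e he) = (coneEquiv e).hFunctor := by
  refine subsetFunctor_ext (fun c => Set.ext fun δ => ?_) fun {c d} g δ hδ hδ' => ?_
  · obtain ⟨s, rfl⟩ := coneEquiv.surjective δ
    change (coneEquiv.symm _ ∈ _ ∧ coneEquiv.symm _ ∈ _) ↔ ∃ f, _ = _
    rw [Equiv.symm_apply_apply, LCat.mem_ideal]
    constructor
    · rintro ⟨hse, hs⟩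
      obtain ⟨f, hf⟩ := exists_hom_gen hs hse
      exact ⟨f, ((principalCone_star e f).trans (congrArg principalCone hf)).symm⟩
    · rintro ⟨f, hf⟩
      obtain rfl := coneEquiv.injective (hf.trans (principalCone_star e f))
      obtain ⟨u, hu⟩ := RCat.exists_map_eq_mul f
      refine ⟨(congrArg (· * e) (hu _)).trans (Eq.trans ?_ (hu _).symm), Subtype.prop _⟩
      exact (mul_assoc u e e).trans (congrArg (u * ·) he.eq)
  · obtain ⟨f, rfl⟩ := hδ'
    refine Eq.trans ?_ (congrArg Subtype.val ((coneEquiv e).hMap_star g f)).symm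
    refine Eq.trans (congrArg coneEquiv ?_) (principalCone_star e (f ≫ g)).symm
    refine congrArg (fun y => (g.1 y).1) (Subtype.ext ?_)
    exact coneEquiv.symm_apply_eq.2 (principalCone_star e f)

/-- The object of the normal dual that corresponds to a left ideal. -/
noncomputable def dualObj (A : LCat S) : NormalDual (RCat S) where
  functor := dualFunctor A
  exists_idem := by
    obtain ⟨e, he, rfl⟩ := LCat.exists_eq_ideal A
    exact ⟨coneEquiv e, (principalCone_mul e e).trans (congrArg principalCone he.eq),
      dualFunctor_ideal he⟩

theorem dualObj_surjective (F : NormalDual (RCat S)) : ∃ A : LCat S, F = dualObj A := by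
  obtain ⟨F, ε, hε, rfl⟩ := F
  obtain ⟨e, rfl⟩ := coneEquiv.surjective ε
  have he : IsIdempotentElem e :=
    principalCone_injective ((principalCone_mul e e).symm.trans hε)
  refine ⟨LCat.ideal e he, ?_⟩
  simp only [dualObj, dualFunctor_ideal]

/-- The elements `s` of `A ∩ c` are the elements of the functor of `A` at `c`. -/
theorem coneEquiv_mem_dualObj {A : LCat S} {c : RCat S} {s : S} :
    coneEquiv s ∈ ((dualObj A).functor.obj c).carrier ↔ s ∈ A.carrier ∧ s ∈ c.carrier := by
  change (coneEquiv.symm _ ∈ _ ∧ coneEquiv.symm _ ∈ _) ↔ _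
  rw [Equiv.symm_apply_apply]

/-- A natural transformation between the functors of two left ideals is right multiplication by
an element of `S`. -/
theorem exists_app_eq_mul {A B : LCat S} (α : dualObj A ⟶ dualObj B) :
    ∃ v : S, ∀ c δ, (α.app c δ).1 = coneEquiv (coneEquiv.symm δ.1 * v) := by
  obtain ⟨e, he, rfl⟩ := LCat.exists_eq_ideal A
  have hmem : coneEquiv e ∈ ((dualObj (LCat.ideal e he)).functor.obj (gen e)).carrier :=
    coneEquiv_mem_dualObj.2 ⟨(LCat.mem_ideal he).2 he, self_mem_gen e⟩
  refine ⟨coneEquiv.symm (α.app (gen e) ⟨_, hmem⟩).1, fun c δ => ?_⟩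
  obtain ⟨δ, hδ⟩ := δ
  obtain ⟨s, rfl⟩ := coneEquiv.surjective δ
  obtain ⟨hse, hs⟩ := coneEquiv_mem_dualObj.1 hδ
  -- naturality for left multiplication by `s`, which sends `e` to `s`
  let g : gen e ⟶ c := homMk s fun x _ => RCat.mul_mem hs x
  have hg : (dualObj (LCat.ideal e he)).functor.map g ⟨_, hmem⟩ = ⟨coneEquiv s, hδ⟩ :=
    Subtype.ext <| congrArg coneEquiv <| (congrArg (s * ·) (coneEquiv.symm_apply_apply e)).trans
      ((LCat.mem_ideal he).1 hse)
  have h := congrArg Subtype.val (congrFun (α.naturality g) ⟨_, hmem⟩)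
  have h' : (α.app c ((dualObj (LCat.ideal e he)).functor.map g ⟨_, hmem⟩)).1 =
    coneEquiv (s * coneEquiv.symm (α.app (gen e) ⟨_, hmem⟩).1) := h
  rw [hg] at h'
  rw [Equiv.symm_apply_apply]
  exact h'

theorem NormalDual.heq_of_apply {F G F' G' : NormalDual (RCat S)} (hF : F = F') (hG : G = G')
    {α : F ⟶ G} {β : F' ⟶ G'} (h : ∀ c x (hx : x ∈ (F.functor.obj c).carrier)
      (hx' : x ∈ (F'.functor.obj c).carrier),
      (α.app c ⟨x, hx⟩).1 = (β.app c ⟨x, hx'⟩).1) : HEq α β := by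
  subst hF hG
  exact heq_of_eq (NatTrans.ext (funext fun c => funext fun x =>
    Subtype.ext (h c x.1 x.2 x.2)))

/-! ### The isomorphism between the normal dual and the category of left ideals -/

variable (S) in
/-- The functor from `L(S)` to the normal dual of `R(S)`. -/
noncomputable def dualOfLCat : LCat S ⥤ NormalDual (RCat S) where
  obj := dualObj
  map f :=
    { app := fun c δ => ⟨coneEquiv (f.1 ⟨coneEquiv.symm δ.1, δ.2.1⟩).1,
        coneEquiv_mem_dualObj.2 ⟨Subtype.prop _, LCat.map_mem f _ δ.2.2⟩⟩
      naturality := fun c d g => by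
        obtain ⟨_, u, _, _, _, _, _, _, hu⟩ := f.2
        obtain ⟨v, hv⟩ := RCat.exists_map_eq_mul g
        funext δ
        refine Subtype.ext (congrArg coneEquiv ?_)
        refine (hu _).trans (Eq.trans ?_ (hv _).symm)
        change coneEquiv.symm (coneEquiv _) * u = v * coneEquiv.symm (coneEquiv _)
        rw [Equiv.symm_apply_apply, Equiv.symm_apply_apply, hu, hv, mul_assoc] }
  map_id A := NatTrans.ext <| funext fun c => funext fun δ => Subtype.ext <|
    coneEquiv.apply_symm_apply δ.1
  map_comp f k := NatTrans.ext <| funext fun c => funext fun δ => Subtype.ext <|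
    congrArg coneEquiv <| congrArg (fun y => (k.1 y).1)
      (Subtype.ext (coneEquiv.symm_apply_apply _).symm)

/-- The union of the values of an object of the normal dual, as a set of elements of `S`. -/
def dualCarrier (F : NormalDual (RCat S)) : Set S :=
  {s | ∃ c, coneEquiv s ∈ (F.functor.obj c).carrier}

theorem dualCarrier_dualObj (A : LCat S) : dualCarrier (dualObj A) = A.carrier :=
  Set.ext fun s => ⟨fun ⟨_, h⟩ => (coneEquiv_mem_dualObj.1 h).1,
    fun h => ⟨gen s, coneEquiv_mem_dualObj.2 ⟨h, self_mem_gen s⟩⟩⟩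

theorem mem_obj_gen {F : NormalDual (RCat S)} {s : S} (hs : s ∈ dualCarrier F) :
    coneEquiv s ∈ (F.functor.obj (gen s)).carrier := by
  obtain ⟨A, rfl⟩ := dualObj_surjective F
  rw [dualCarrier_dualObj] at hs
  exact coneEquiv_mem_dualObj.2 ⟨hs, self_mem_gen s⟩

/-- The left ideal of an object of the normal dual. -/
def lcatObj (F : NormalDual (RCat S)) : LCat S where
  carrier := dualCarrier F
  principal := by
    obtain ⟨A, rfl⟩ := dualObj_surjective F
    rw [dualCarrier_dualObj]
    exact A.principal

theorem lcatObj_dualObj (A : LCat S) : lcatObj (dualObj A) = A :=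
  LCat.ext (dualCarrier_dualObj A)

/-- The right translation induced by a natural transformation: the image of `s` is computed in the
component at the right ideal `sS`. -/
noncomputable def lcatMap {F G : NormalDual (RCat S)} (α : F ⟶ G) : lcatObj F ⟶ lcatObj G :=
  ⟨fun s => ⟨coneEquiv.symm (α.app (gen s.1) ⟨coneEquiv s.1, mem_obj_gen s.2⟩).1, gen s.1, by
    rw [Equiv.apply_symm_apply]
    exact Subtype.prop _⟩, by
    obtain ⟨A, rfl⟩ := dualObj_surjective F
    obtain ⟨B, rfl⟩ := dualObj_surjective G
    obtain ⟨v, hv⟩ := exists_app_eq_mul α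
    refine LCat.isRightTranslation_of _ v fun s => ?_
    change coneEquiv.symm (α.app _ _).1 = _
    rw [hv, Equiv.symm_apply_apply, Equiv.symm_apply_apply]⟩

/-- The component at any object containing `s` computes the image of `s`. -/
theorem lcatMap_apply {F G : NormalDual (RCat S)} (α : F ⟶ G) (s : (lcatObj F).carrier)
    (c : RCat S) (hs : coneEquiv s.1 ∈ (F.functor.obj c).carrier) :
    ((lcatMap α).1 s).1 = coneEquiv.symm (α.app c ⟨coneEquiv s.1, hs⟩).1 := by
  obtain ⟨A, rfl⟩ := dualObj_surjective F
  obtain ⟨B, rfl⟩ := dualObj_surjective G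
  obtain ⟨v, hv⟩ := exists_app_eq_mul α
  change coneEquiv.symm (α.app _ _).1 = _
  rw [hv, hv]

variable (S) in
/-- The functor from the normal dual of `R(S)` to `L(S)`. -/
noncomputable def lcatOfDual : NormalDual (RCat S) ⥤ LCat S where
  obj := lcatObj
  map α := lcatMap α
  map_id F := LCat.hom_ext fun s => coneEquiv.symm_apply_apply s.1
  map_comp {F G K} α β := LCat.hom_ext fun s => by
    have hs := ((lcatMap α).1 s).2
    have hmem : coneEquiv ((lcatMap α).1 s).1 ∈ (G.functor.obj (gen s.1)).carrier := by
      rw [lcatMap_apply α s _ (mem_obj_gen s.2), Equiv.apply_symm_apply]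
      exact Subtype.prop _
    refine Eq.trans ?_ (lcatMap_apply β _ _ hmem).symm
    refine congrArg coneEquiv.symm (congrArg (fun y => (β.app (gen s.1) y).1) ?_)
    exact Subtype.ext (coneEquiv.apply_symm_apply _).symm

variable (S) in
/-- The normal dual of `R(S)` is isomorphic to `L(S)`. -/
noncomputable def normalDualIso : NormalIso (NormalDual (RCat S)) (LCat S) where
  functor := lcatOfDual S
  inverse := dualOfLCat S
  functor_inverse := by
    have hobj : ∀ F : NormalDual (RCat S), dualObj (lcatObj F) = F := fun F => by
      obtain ⟨A, rfl⟩ := dualObj_surjective F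
      rw [lcatObj_dualObj]
    refine CategoryTheory.Functor.hext hobj fun F G α =>
      NormalDual.heq_of_apply (hobj F) (hobj G) fun c δ hδ hδ' => ?_
    obtain ⟨s, rfl⟩ := coneEquiv.surjective δ
    have hs := (coneEquiv_mem_dualObj.1 hδ).1
    refine Eq.trans (congrArg (fun y => coneEquiv ((lcatMap α).1 y).1)
      (Subtype.ext (coneEquiv.symm_apply_apply s) : _ = (⟨s, hs⟩ : (lcatObj F).carrier))) ?_
    exact coneEquiv.eq_symm_apply.1 (lcatMap_apply α ⟨s, hs⟩ c hδ')
  inverse_functor := by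
    refine CategoryTheory.Functor.hext lcatObj_dualObj fun A B f =>
      LCat.heq_of_apply (lcatObj_dualObj A) (lcatObj_dualObj B) fun x hx hx' => ?_
    refine (coneEquiv.symm_apply_apply _).trans ?_
    exact congrArg (fun y => (f.1 y).1) (Subtype.ext (coneEquiv.symm_apply_apply x))
  functor_incl h := ⟨fun _ ⟨c, hc⟩ => ⟨c, h.1 c hc⟩,
    LCat.hom_ext fun s => coneEquiv.symm_apply_apply s.1⟩
  inverse_incl h := by
    refine ⟨⟨fun c δ hδ => ⟨h hδ.1, hδ.2⟩, fun _ _ => rfl⟩, ?_⟩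
    exact NatTrans.ext (funext fun c => funext fun δ =>
      Subtype.ext (coneEquiv.apply_symm_apply δ.1))

end Dual

end CrossConnection

theorem mainTheorem4 {S : Type*} [Semigroup S] [CrossConnection.IsCliffordSemigroup S] :
    Nonempty (CrossConnection.NormalCone (CrossConnection.RCat S) ≃* Sᵐᵒᵖ) ∧
    Nonempty (CrossConnection.NormalIso
      (CrossConnection.NormalDual (CrossConnection.RCat S)) (CrossConnection.LCat S)) :=
  ⟨⟨CrossConnection.coneMulEquiv S⟩, ⟨CrossConnection.normalDualIso S⟩⟩
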